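/- Let $G=(V,E)$ be a finite directed graph with real capacities $C_{ij}$ and linear costs $f_{ij}\in\mathbb R$ on the edges, three distinct source nodes, numbered $S=\{1,2,3\}$, with storage costs $d_1,d_2,d_3\ge 0$, a nonempty set $T\subseteq V$ of terminals, and an original source of entropy $h\ge 0$. Let $G^*=(V^*,E^*)$ arise from $G$ by adding a node $s^*$ and edges $(s^*,i)$, $i\in S$, of infinite capacity; write $c^*$ for the capacities of $G^*$. A *feasible flow* consists of reals $x^{(t)}_{ij},z_{ij}$ ($t\in T$, $(i,j)\in E^*$) with $0\le x^{(t)}_{ij}\le z_{ij}\le c^*_{ij}$ and $$\sum_{j:(i,j)\in E^*}x^{(t)}_{ij}-\sum_{j:(j,i)\in E^*}x^{(t)}_{ji}=\sigma^{(t)}_i\qquad(i\in V^*,\ t\in T),$$ where $\sigma^{(t)}_{s^*}=h$, $\sigma^{(t)}_t=-h$ and $\sigma^{(t)}_i=0$ otherwise. Assume that a feasible flow exists. Let $\mathcal A$ be the set of the $7$ nonempty atoms of the field generated by $\tilde X_1,\tilde X_2,\tilde X_3$, and put $\tilde X_W=\bigcup_{i\in W}\tilde X_i$. For $\mu:\mathcal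 A\to\mathbb R$ write $H(X_i)=\sum_{A\subseteq\tilde X_i}\mu(A)$, $H(X_U\mid X_{S\setminus U})=\sum_{A\not\subseteq\tilde X_{S\setminus U}}\mu(A)$ and $I(X_i;X_j\mid X_K)=\sum_{A\subseteq\tilde X_i,\,A\subseteq\tilde X_j,\,A\not\subseteq\tilde X_K}\mu(A)$. Consider the constraints (*) on $x,z,\mu$ and rates $R^{(t)}_i$ ($t\in T$, $i\in S$): $(x,z)$ is a feasible flow; $x^{(t)}_{s^*i}\ge R^{(t)}_i$; $\sum_{i\in U}R^{(t)}_i\ge H(X_U\mid X_{S\setminus U})$ for all $U\subseteq S$; $z_{s^*i}=H(X_i)$; and $\sum_{A\in\mathcal A}\mu(A)=h$. * CODED-MIN-COST: minimize $\sum_{(i,j)\in E}f_{ij}z_{ij}+\sum_{i\in S}d_iz_{s^*i}$ over feasible flows. * SUBSET-MIN-COST: minimize $\sum_{(i,j)\in E}f_{ij}z_{ij}+\sum_{A\in\mathcal A}\bigl(\sum_{i:A\subseteq\tilde X_i}d_i\bigr)\mu(A)$ subject to (*) and $\mu(A)\ge 0$ for all $A\in\mathcal A$. * ATOM-CODED-MIN-COST: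 minimize $\sum_{(i,j)\in E}f_{ij}z_{ij}+\sum_{i\in S}d_iz_{s^*i}$ subject to (*) and the elemental inequalities $H(X_i\mid X_{S\setminus\{i\}})\ge 0$ for all $i$ and $I(X_i;X_j\mid X_K)\ge 0$ for all $i\ne j$ and $K\subseteq S\setminus\{i,j\}$. Then all three problems attain their optimal values, and those of CODED-MIN-COST and ATOM-CODED-MIN-COST are equal. Let $f_{\rm subset}$ and $f_{\rm coded}$ be the optimal values of SUBSET-MIN-COST and CODED-MIN-COST, and let $b^*=\mu(\tilde X_1\cap\tilde X_2\cap\tilde X_3)$ in any optimal solution of ATOM-CODED-MIN-COST. If $b^*\ge 0$, then $f_{\rm subset}=f_{\rm coded}$. If $b^*<0$, then $$f_{\rm subset}-f_{\rm coded}\ \le\ \bigl(\min_{i\in S}d_i\bigr)\,|b^*|\ \le\ \bigl(\min_{i\in S}d_i\bigr)\,\frac h2 .$$ Moreover the bound is attained: there is a network with nine nodes $1,\dots,9$, source nodes $1,2,3$, terminals $6,7,8,9$, unit capacities and unit costs on all edges, $d_1=d_2=2$, $d_3=1$ and $h=2$, for which $f_{\rm subset}=17$ and $f_{\rm coded}=16$,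 and every optimal solution of ATOM-CODED-MIN-COST has $b^*<0$ and $f_{\rm subset}-f_{\rm coded}=(\min_i d_i)|b^*|=(\min_i d_i)h/2$. -/

import Mathlib

/-- A directed network `G = (V, E, C)` with `n` numbered source nodes, a nonempty set of terminals,
linear edge costs `f`, linear storage costs `d` and an original source of entropy `h`.
The values of `cap` and `f` matter only on pairs that are edges. -/
structure Network (V : Type*) (n : ℕ) where
  edges : Finset (V × V)
  cap : V → V → ℝ
  f : V → V → ℝ
  src : Fin n ↪ V
  terminals : Finset V
  terminals_nonempty : terminals.Nonempty
  d : Fin n → ℝ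
  d_nonneg : ∀ i, 0 ≤ d i
  h : ℝ
  h_nonneg : 0 ≤ h

/-- A nonempty atom of the field generated by `X̃₁, …, X̃ₙ`, encoded by the nonempty set of those
indices `i` for which the atom is contained in `X̃ᵢ` (it is contained in the complement of the
other `X̃ᵢ`). -/
abbrev Atom (n : ℕ) : Type := {A : Finset (Fin n) // A.Nonempty}

namespace Atom

variable {n : ℕ}

/-- The atom is contained in `X̃_W = ⋃_{i ∈ W} X̃ᵢ`. -/
abbrev Sub (A : Atom n) (W : Finset (Fin n)) : Prop := ∃ i ∈ W, i ∈ A.1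

/-- The atom `X̃₁ ∩ X̃₂ ∩ X̃₃`. -/
def triple : Atom 3 := ⟨Finset.univ, Finset.univ_nonempty⟩

end Atom

section Measure

variable {n : ℕ}

/-- `H(X_i)`, the sum of `μ(A)` over atoms `A ⊆ X̃ᵢ`. -/
def entropy (μ : Atom n → ℝ) (i : Fin n) : ℝ := ∑ A with A.Sub {i}, μ A

/-- `H(X_U | X_{S∖U})`, the sum of `μ(A)` over atoms `A ⊄ X̃_{S∖U}`. -/
def condEntropy (μ : Atom n → ℝ) (U : Finset (Fin n)) : ℝ := ∑ A with ¬ A.Sub Uᶜ, μ A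

/-- `I(X_i ; X_j | X_K)`, the sum of `μ(A)` over atoms `A ⊆ X̃ᵢ`, `A ⊆ X̃ⱼ`, `A ⊄ X̃_K`. -/
def condMutualInfo (μ : Atom n → ℝ) (i j : Fin n) (K : Finset (Fin n)) : ℝ :=
  ∑ A with A.Sub {i} ∧ A.Sub {j} ∧ ¬ A.Sub K, μ A

/-- The Slepian–Wolf region of the sources with atom measures `μ`. -/
def slepianWolf (μ : Atom n → ℝ) : Set (Fin n → ℝ) :=
  {R | ∀ U : Finset (Fin n), condEntropy μ U ≤ ∑ i ∈ U, R i}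

/-- The elemental (hence all Shannon type) inequalities. -/
def Elemental (μ : Atom n → ℝ) : Prop :=
  (∀ i, 0 ≤ condEntropy μ {i}) ∧
  ∀ i j, i ≠ j → ∀ K : Finset (Fin n), i ∉ K → j ∉ K → 0 ≤ condMutualInfo μ i j K

end Measure

/-- Flow variables on the augmented graph, whose vertex set is `Option V` with `none` the virtual
super node `s*`: `x t u v` is the flow for terminal `t` on the edge `(u, v)`, `z u v` the amount
of flow paid for on that edge. Only the values at terminals `t` and at edges `(u, v)` matter. -/
structure FlowVars (V : Type*) where
  x : V → Option V → Option V → ℝ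
  z : Option V → Option V → ℝ

/-- Flow variables, rates `R t i` from source `i` to terminal `t`, and atom measures `μ`. -/
structure AtomVars (V : Type*) (n : ℕ) extends FlowVars V where
  R : V → Fin n → ℝ
  μ : Atom n → ℝ

namespace Network

variable {V : Type*} [Fintype V] [DecidableEq V] {n : ℕ} (N : Network V n)

/-- Edges of the augmented graph `G*`: those of `G`, and `(s*, i)` for every source node `i`. -/
def augEdges : Finset (Option V × Option V) :=
  N.edges.image (fun e => (some e.1, some e.2)) ∪
    Finset.univ.image (fun i => (none, some (N.src i)))

/-- Capacities in `G*`; the virtual edges have infinite capacity. -/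
noncomputable def augCap : Option V → Option V → EReal
  | some u, some v => (N.cap u v : EReal)
  | _, _ => ⊤

/-- The net outflow `σ` prescribed at a vertex for terminal `t`. -/
def sigma (t : V) (v : Option V) : ℝ :=
  if v = none then N.h else if v = some t then -N.h else 0

/-- `0 ≤ x ≤ z ≤ c*` on all edges of `G*`, and flow balance at all vertices of `G*`. -/
def FlowFeasible (p : FlowVars V) : Prop :=
  (∀ t ∈ N.terminals, ∀ u v, (u, v) ∈ N.augEdges →
    0 ≤ p.x t u v ∧ p.x t u v ≤ p.z u v ∧ (p.z u v : EReal) ≤ N.augCap u v) ∧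
  ∀ t ∈ N.terminals, ∀ v,
    ∑ w with (v, w) ∈ N.augEdges, p.x t v w - ∑ w with (w, v) ∈ N.augEdges, p.x t w v = N.sigma t v

/-- Cost of the flow over the edges of `G`. -/
def edgeCost (p : FlowVars V) : ℝ := ∑ e ∈ N.edges, N.f e.1 e.2 * p.z (some e.1) (some e.2)

/-- Objective `∑ f z + ∑ dᵢ z_{s* i}`. -/
def codedCost (p : FlowVars V) : ℝ :=
  N.edgeCost p + ∑ i, N.d i * p.z none (some (N.src i))

/-- Objective `∑ f z + ∑_A (∑_{i : A ⊆ X̃ᵢ} dᵢ) μ(A)`. -/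
def subsetCost (p : AtomVars V n) : ℝ :=
  N.edgeCost p.toFlowVars + ∑ A : Atom n, (∑ i with A.Sub {i}, N.d i) * p.μ A

/-- The constraints shared by SUBSET-MIN-COST and ATOM-CODED-MIN-COST. -/
def AtomFeasible (p : AtomVars V n) : Prop :=
  N.FlowFeasible p.toFlowVars ∧
  (∀ t ∈ N.terminals, ∀ i, p.R t i ≤ p.x t none (some (N.src i))) ∧
  (∀ t ∈ N.terminals, p.R t ∈ slepianWolf p.μ) ∧
  (∀ i, p.z none (some (N.src i)) = entropy p.μ i) ∧
  N.h = ∑ A, p.μ A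

/-- Feasibility for SUBSET-MIN-COST. -/
def SubsetFeasible (p : AtomVars V n) : Prop := N.AtomFeasible p ∧ ∀ A, 0 ≤ p.μ A

/-- Feasibility for ATOM-CODED-MIN-COST. -/
def AtomCodedFeasible (p : AtomVars V n) : Prop := N.AtomFeasible p ∧ Elemental p.μ

/-- Optimal solutions of ATOM-CODED-MIN-COST. -/
def AtomCodedOptimal (p : AtomVars V n) : Prop :=
  N.AtomCodedFeasible p ∧
    ∀ q, N.AtomCodedFeasible q → N.codedCost p.toFlowVars ≤ N.codedCost q.toFlowVars

/-- `c` is the optimal value of CODED-MIN-COST (whose feasible points are the feasible flows). -/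
def IsCodedMinCost (c : ℝ) : Prop := IsLeast (N.codedCost '' {p | N.FlowFeasible p}) c

/-- `c` is the optimal value of SUBSET-MIN-COST. -/
def IsSubsetMinCost (c : ℝ) : Prop := IsLeast (N.subsetCost '' {p | N.SubsetFeasible p}) c

end Network

/-- The minimum of the storage costs of three sources. -/
def Network.minD {V : Type*} (N : Network V 3) : ℝ :=
  Finset.univ.inf' Finset.univ_nonempty N.d

/-!
Storage `z_{s*i}` in excess of `h` is wasted, so let `z_{s*i} ≤ h`. The set function
`W ↦ min h (∑ i ∈ W, z_{s*i})` is a polymatroid, hence the joint entropy function of an elemental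
atom measure, and the virtual flows of every terminal lie in its Slepian–Wolf region. So every flow
extends to a point of ATOM-CODED-MIN-COST of the same cost, and the two optimal values agree.

With three sources the elemental inequalities force all atoms except the triple intersection to have
nonnegative measure, and the triple intersection to have measure `b ≥ -μ(A)` for each of the three
pair atoms `A`; hence `|b| ≤ h / 2` if `b < 0`. Moving mass `|b|` from the pair atom avoiding a
cheapest source `k` into the triple intersection makes the measure nonnegative. Only `H(X_k)` grows,
by `|b|`, and no conditional entropy grows, so the rates stay admissible and the cost rises by
`d_k |b|`.

In the tight example every terminal is separated from `s*` by two-edge cuts, which saturate all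
edges and leave every source without flow to some terminal.
-/

theorem exists_sum_powerset_eq {α M : Type*} [AddCommGroup M] (F : Finset α → M) :
    ∃ m : Finset α → M, ∀ U, ∑ B ∈ U.powerset, m B = F U := by
  classical
  let m : Finset α → M :=
    Finset.strongInduction fun U m => F U - ∑ B ∈ U.ssubsets.attach,
      m B (Finset.mem_ssubsets.1 B.2)
  refine ⟨m, fun U => ?_⟩
  have hm : m U = F U - ∑ B ∈ U.ssubsets, m B := by
    rw [← Finset.sum_attach U.ssubsets m]
    exact Finset.strongInduction_eq _ U
  rw [← Finset.insert_erase (Finset.mem_powerset_self U),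
    Finset.sum_insert (Finset.notMem_erase U _), hm]
  exact sub_add_cancel _ _

theorem posPart_sub_add_posPart_sub_le {α : Type*} [AddCommGroup α] [LinearOrder α]
    [IsOrderedAddMonoid α] {a b : α} (ha : 0 ≤ a) (hb : 0 ≤ b) (c : α) :
    (c - a)⁺ + (c - b)⁺ ≤ c⁺ + (c - (a + b))⁺ := by
  simp only [posPart_def]
  grind

theorem sum_outflow_sub_sum_inflow {α M : Type*} [Fintype α] [DecidableEq α] [AddCommGroup M]
    (E : Finset (α × α)) (W : Finset α) (x : α → α → M) :
    ∑ v ∈ W, (∑ w with (v, w) ∈ E, x v w - ∑ w with (w, v) ∈ E, x w v) =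
      ∑ e ∈ E with e.1 ∈ W ∧ e.2 ∉ W, x e.1 e.2 - ∑ e ∈ E with e.1 ∉ W ∧ e.2 ∈ W, x e.1 e.2 := by
  have hout : ∑ v ∈ W, ∑ w with (v, w) ∈ E, x v w = ∑ e ∈ E with e.1 ∈ W, x e.1 e.2 :=
    (Finset.sum_finset_product' _ _ _ (by simp [and_comm])).symm
  have hin : ∑ v ∈ W, ∑ w with (w, v) ∈ E, x w v = ∑ e ∈ E with e.2 ∈ W, x e.1 e.2 :=
    (Finset.sum_finset_product_right' _ _ _ (by simp [and_comm])).symm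
  rw [Finset.sum_sub_distrib, hout, hin]
  simp only [Finset.sum_filter, ← Finset.sum_sub_distrib]
  refine Finset.sum_congr rfl fun e _ => ?_
  split_ifs <;> grind

namespace Atom

variable {n : ℕ}

/-- The atom contained in `X̃ᵢ` only. -/
def single (i : Fin n) : Atom n := ⟨{i}, Finset.singleton_nonempty i⟩

/-- The atom obtained from `A` by replacing the complement of `X̃ₖ` with `X̃ₖ`. -/
protected def insert (k : Fin n) (A : Atom n) : Atom n :=
  ⟨insert k A.1, Finset.insert_nonempty k A.1⟩

/-- The atom contained in both `X̃ⱼ` with `j ≠ i`, but not in `X̃ᵢ`. -/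
def pairAvoiding (i : Fin 3) : Atom 3 := ⟨{i}ᶜ, by fin_cases i <;> decide⟩

theorem insert_pairAvoiding (k : Fin 3) : (pairAvoiding k).insert k = triple := by
  fin_cases k <;> decide

theorem sum_three (g : Atom 3 → ℝ) :
    ∑ A, g A = ∑ i, g (single i) + ∑ i, g (pairAvoiding i) + g triple := by
  have huniv : (Finset.univ : Finset (Atom 3)) = {single 0, single 1, single 2,
      pairAvoiding 0, pairAvoiding 1, pairAvoiding 2, triple} := by decide
  rw [huniv]
  iterate 6 rw [Finset.sum_insert (by decide)]
  rw [Finset.sum_singleton, Fin.sum_univ_three, Fin.sum_univ_three]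
  ring

theorem sub_singleton_iff {A : Atom n} {i : Fin n} : A.Sub {i} ↔ i ∈ A.1 := by
  simp only [Atom.Sub, Finset.mem_singleton, exists_eq_left]

theorem not_sub_compl_iff {A : Atom n} {U : Finset (Fin n)} : ¬ A.Sub Uᶜ ↔ A.1 ⊆ U := by
  simp [Finset.subset_iff, not_imp_not]

end Atom

section AtomMeasure

open Atom

variable {n : ℕ} {μ : Atom n → ℝ}

theorem condEntropy_eq_sum_subset (μ : Atom n → ℝ) (U : Finset (Fin n)) :
    condEntropy μ U = ∑ A with A.1 ⊆ U, μ A := by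
  simp only [condEntropy, not_sub_compl_iff]

theorem condEntropy_compl (μ : Atom n → ℝ) (K : Finset (Fin n)) :
    condEntropy μ Kᶜ = ∑ A with ¬ A.Sub K, μ A := by
  rw [condEntropy, compl_compl]

theorem condEntropy_univ (μ : Atom n → ℝ) : condEntropy μ Finset.univ = ∑ A, μ A := by
  simp [condEntropy_eq_sum_subset]

theorem condEntropy_singleton (μ : Atom n → ℝ) (i : Fin n) :
    condEntropy μ {i} = μ (single i) := by
  rw [condEntropy_eq_sum_subset, ← Finset.sum_singleton μ (single i)]
  congr 1
  ext A
  simp [Finset.subset_singleton_iff, A.2.ne_empty, Subtype.ext_iff, single]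

theorem entropy_eq_sub_condEntropy (μ : Atom n → ℝ) (i : Fin n) :
    entropy μ i = ∑ A, μ A - condEntropy μ {i}ᶜ := by
  rw [condEntropy_compl, entropy, eq_sub_iff_add_eq, Finset.sum_filter_add_sum_filter_not]

theorem condMutualInfo_eq_condEntropy (μ : Atom n → ℝ) (i j : Fin n) (K : Finset (Fin n)) :
    condMutualInfo μ i j K = condEntropy μ Kᶜ + condEntropy μ (insert i (insert j K))ᶜ
      - condEntropy μ (insert i K)ᶜ - condEntropy μ (insert j K)ᶜ := by
  simp only [condMutualInfo, condEntropy_compl, Finset.sum_filter, ← Finset.sum_add_distrib,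
    ← Finset.sum_sub_distrib]
  refine Finset.sum_congr rfl fun A _ => ?_
  simp only [Atom.Sub, Finset.exists_mem_insert, Finset.mem_singleton, exists_eq_left]
  by_cases hi : i ∈ A.1 <;> by_cases hj : j ∈ A.1 <;> simp [hi, hj]

theorem exists_condEntropy_eq (F : Finset (Fin n) → ℝ) (hF : F ∅ = 0) :
    ∃ μ : Atom n → ℝ, ∀ U, condEntropy μ U = F U := by
  obtain ⟨m, hm⟩ := exists_sum_powerset_eq F
  have hm_empty : m ∅ = 0 := by simpa [hF] using hm ∅
  refine ⟨fun A => m A.1, fun U => ?_⟩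
  rw [← hm U, condEntropy_eq_sum_subset, ← Finset.sum_filter_add_sum_filter_not U.powerset
    Finset.Nonempty]
  have hnot : ∑ B ∈ U.powerset with ¬ B.Nonempty, m B = 0 :=
    Finset.sum_eq_zero fun B hB => by
      rw [Finset.not_nonempty_iff_eq_empty.1 (Finset.mem_filter.1 hB).2, hm_empty]
  rw [hnot, add_zero]
  exact Finset.sum_bij (fun A _ => A.1) (fun A hA => by simpa [A.2] using hA)
    (fun _ _ _ _ => Subtype.ext) (fun B hB => by simpa [and_comm] using hB) fun _ _ => rfl

theorem sum_mul_entropy (d : Fin n → ℝ) (μ : Atom n → ℝ) :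
    ∑ i, d i * entropy μ i = ∑ A : Atom n, (∑ i with A.Sub {i}, d i) * μ A := by
  simp only [entropy, Finset.mul_sum, Finset.sum_mul, Finset.sum_filter, mul_ite, ite_mul,
    mul_zero, zero_mul]
  rw [Finset.sum_comm]

theorem isUpperSet_slepianWolf (μ : Atom n → ℝ) : IsUpperSet (slepianWolf μ) :=
  fun _ _ hRR' hR U => (hR U).trans (Finset.sum_le_sum fun i _ => hRR' i)

theorem isClosed_setOf_mem_slepianWolf :
    IsClosed {q : (Fin n → ℝ) × (Atom n → ℝ) | q.1 ∈ slepianWolf q.2} := by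
  have hinter : {q : (Fin n → ℝ) × (Atom n → ℝ) | q.1 ∈ slepianWolf q.2} =
      ⋂ U : Finset (Fin n), {q | condEntropy q.2 U ≤ ∑ i ∈ U, q.1 i} := by
    ext q
    simp [slepianWolf]
  rw [hinter]
  simp only [condEntropy]
  exact isClosed_iInter fun U => isClosed_le (by fun_prop) (by fun_prop)

theorem sum_entropy_three (μ : Atom 3 → ℝ) :
    ∑ i, entropy μ i = 2 * ∑ A, μ A - ∑ i, μ (single i) + μ triple := by
  simp +decide only [entropy, Finset.sum_filter, Atom.sum_three, Fin.sum_univ_three, if_true,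
    if_false]
  ring

theorem entropy_le_sum (hμ : ∀ A, 0 ≤ μ A) (i : Fin n) : entropy μ i ≤ ∑ A, μ A :=
  Finset.sum_le_univ_sum_of_nonneg hμ

theorem condMutualInfo_compl (μ : Atom n → ℝ) (i j : Fin n) (U : Finset (Fin n)) :
    condMutualInfo μ i j Uᶜ = ∑ A with {i, j} ⊆ A.1 ∧ A.1 ⊆ U, μ A := by
  simp only [condMutualInfo, not_sub_compl_iff, sub_singleton_iff, Finset.insert_subset_iff,
    Finset.singleton_subset_iff, and_assoc]

theorem condMutualInfo_compl_self {A : Atom n} {i j : Fin n} (hA : A.1 = {i, j}) :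
    condMutualInfo μ i j A.1ᶜ = μ A := by
  rw [condMutualInfo_compl, ← hA, ← Finset.sum_singleton μ A]
  congr 1
  ext B
  simp only [Finset.mem_filter_univ, Finset.mem_singleton, Subtype.ext_iff]
  exact ⟨fun h => h.2.antisymm h.1, fun h => ⟨h.ge, h.le⟩⟩

theorem condMutualInfo_compl_insert {A : Atom n} {i j k : Fin n} (hA : A.1 = {i, j})
    (hk : k ∉ A.1) : condMutualInfo μ i j (insert k A.1)ᶜ = μ A + μ (A.insert k) := by
  have hne : A ≠ A.insert k := fun h => hk (by rw [h]; exact Finset.mem_insert_self k _)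
  rw [condMutualInfo_compl, ← hA, ← Finset.sum_pair hne]
  congr 1
  ext B
  simp only [Finset.mem_filter_univ, Finset.mem_insert, Finset.mem_singleton, Subtype.ext_iff,
    Atom.insert]
  grind

theorem Elemental.nonneg_of_card_le_two (hμ : Elemental μ) {A : Atom n} (hA : A.1.card ≤ 2) :
    0 ≤ μ A := by
  obtain hA | hA : A.1.card = 1 ∨ A.1.card = 2 := by have := A.2.card_pos; omega
  · obtain ⟨i, hi⟩ := Finset.card_eq_one.1 hA
    rw [show A = single i from Subtype.ext hi, ← condEntropy_singleton μ]
    exact hμ.1 i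
  · obtain ⟨i, j, hij, hA⟩ := Finset.card_eq_two.1 hA
    rw [← condMutualInfo_compl_self (μ := μ) hA]
    exact hμ.2 i j hij _ (by simp [hA]) (by simp [hA])

theorem Elemental.add_insert_nonneg (hμ : Elemental μ) {A : Atom n} (hA : A.1.card = 2)
    {k : Fin n} (hk : k ∉ A.1) : 0 ≤ μ A + μ (A.insert k) := by
  obtain ⟨i, j, hij, hA⟩ := Finset.card_eq_two.1 hA
  rw [← condMutualInfo_compl_insert hA hk]
  exact hμ.2 i j hij _ (by simp [hA]) (by simp [hA])

theorem Elemental.nonneg_of_ne_triple {μ : Atom 3 → ℝ} (hμ : Elemental μ) {A : Atom 3}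
    (hA : A ≠ triple) : 0 ≤ μ A :=
  hμ.nonneg_of_card_le_two (Nat.le_of_lt_succ
    (Finset.card_lt_iff_ne_univ A.1 |>.2 fun h => hA (Subtype.ext h)))

theorem Elemental.pairAvoiding_add_triple_nonneg {μ : Atom 3 → ℝ} (hμ : Elemental μ) (k : Fin 3) :
    0 ≤ μ (pairAvoiding k) + μ triple := by
  rw [← insert_pairAvoiding k]
  exact hμ.add_insert_nonneg (by simp [pairAvoiding, Finset.card_compl]) (by simp [pairAvoiding])

theorem Elemental.neg_triple_le {μ : Atom 3 → ℝ} (hμ : Elemental μ) :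
    -μ triple ≤ (∑ A, μ A) / 2 := by
  have hsingle : 0 ≤ ∑ i, μ (single i) :=
    Finset.sum_nonneg fun i _ => hμ.nonneg_of_card_le_two (by simp [single])
  have hpair : 0 ≤ ∑ i, (μ (pairAvoiding i) + μ triple) :=
    Finset.sum_nonneg fun i _ => hμ.pairAvoiding_add_triple_nonneg i
  rw [Finset.sum_add_distrib, Finset.sum_const, Finset.card_univ, Fintype.card_fin,
    nsmul_eq_mul, Nat.cast_ofNat] at hpair
  rw [sum_three]
  linarith

/-- The atom measure `μ` realises the joint entropies `H(X_W) = min h (∑ i ∈ W, g i)`, stated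
through the conditional entropies `H(X_U | X_{S∖U}) = h - H(X_{S∖U})`. -/
def HasTruncatedEntropy (μ : Atom n → ℝ) (h : ℝ) (g : Fin n → ℝ) : Prop :=
  ∀ U, condEntropy μ U = (h - ∑ i ∈ Uᶜ, g i)⁺

theorem exists_hasTruncatedEntropy {h : ℝ} {g : Fin n → ℝ} (hg : h ≤ ∑ i, g i) :
    ∃ μ : Atom n → ℝ, HasTruncatedEntropy μ h g :=
  exists_condEntropy_eq _ (by simpa using hg)

namespace HasTruncatedEntropy

variable {h : ℝ} {g R : Fin n → ℝ}

theorem elemental (hμ : HasTruncatedEntropy μ h g) (hg : ∀ i, 0 ≤ g i) : Elemental μ := by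
  refine ⟨fun i => (posPart_nonneg _).trans_eq (hμ {i}).symm, fun i j hij K hi hj => ?_⟩
  have := posPart_sub_add_posPart_sub_le (hg i) (hg j) (h - ∑ l ∈ K, g l)
  rw [condMutualInfo_eq_condEntropy, hμ, hμ, hμ, hμ]
  simp only [compl_compl]
  rw [Finset.sum_insert (by simp [hij, hi]), Finset.sum_insert hi, Finset.sum_insert hj]
  ring_nf at this ⊢
  linarith

theorem sum_eq (hμ : HasTruncatedEntropy μ h g) (hh : 0 ≤ h) : ∑ A, μ A = h := by
  rw [← condEntropy_univ, hμ, Finset.compl_univ, Finset.sum_empty, sub_zero, posPart_eq_self.2 hh]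

theorem entropy_eq (hμ : HasTruncatedEntropy μ h g) {i : Fin n} (hi : 0 ≤ g i) (hih : g i ≤ h) :
    entropy μ i = g i := by
  rw [entropy_eq_sub_condEntropy, hμ.sum_eq (hi.trans hih), hμ, compl_compl, Finset.sum_singleton,
    posPart_eq_self.2 (sub_nonneg.2 hih), sub_sub_cancel]

theorem mem_slepianWolf (hμ : HasTruncatedEntropy μ h g) (hR : ∀ i, 0 ≤ R i)
    (hRg : ∀ i, R i ≤ g i) (hRh : h ≤ ∑ i, R i) : R ∈ slepianWolf μ := by
  intro U
  rw [hμ]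
  refine sup_le ?_ (Finset.sum_nonneg fun i _ => hR i)
  have hle : ∑ i ∈ Uᶜ, R i ≤ ∑ i ∈ Uᶜ, g i := Finset.sum_le_sum fun i _ => hRg i
  have hsplit := Finset.sum_add_sum_compl U R
  linarith

end HasTruncatedEntropy

/-- The atom measure obtained from `μ` by moving mass `c` from the atom `A` to `A.insert k`, which
raises the entropy of `Xₖ` alone and keeps the total mass. -/
def Atom.transfer (μ : Atom n → ℝ) (A : Atom n) (k : Fin n) (c : ℝ) : Atom n → ℝ :=
  μ + Pi.single (A.insert k) c - Pi.single A c

namespace Atom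

variable {A : Atom n} {k : Fin n} {c : ℝ}

theorem sum_filter_transfer (μ : Atom n → ℝ) (A : Atom n) (k : Fin n) (c : ℝ)
    (P : Atom n → Prop) [DecidablePred P] :
    ∑ B with P B, transfer μ A k c B = ∑ B with P B, μ B
      + (if P (A.insert k) then c else 0) - (if P A then c else 0) := by
  simp [transfer, Finset.sum_add_distrib, Finset.sum_sub_distrib, Finset.sum_pi_single']

theorem sum_transfer (μ : Atom n → ℝ) (A : Atom n) (k : Fin n) (c : ℝ) :
    ∑ B, transfer μ A k c B = ∑ B, μ B := by
  simp [transfer, Finset.sum_add_distrib, Finset.sum_sub_distrib]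

theorem entropy_transfer (μ : Atom n → ℝ) (hk : k ∉ A.1) (c : ℝ) (i : Fin n) :
    entropy (transfer μ A k c) i = entropy μ i + if i = k then c else 0 := by
  rw [entropy, sum_filter_transfer, ← entropy]
  simp only [sub_singleton_iff, Atom.insert, Finset.mem_insert]
  grind

theorem condEntropy_transfer_le (μ : Atom n → ℝ) (A : Atom n) (k : Fin n) (hc : 0 ≤ c)
    (U : Finset (Fin n)) : condEntropy (transfer μ A k c) U ≤ condEntropy μ U := by
  have hsub : (A.insert k).1 ⊆ U → A.1 ⊆ U := (Finset.subset_insert k A.1).trans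
  rw [condEntropy_eq_sum_subset, sum_filter_transfer, ← condEntropy_eq_sum_subset]
  split_ifs <;> grind

theorem slepianWolf_subset_transfer (μ : Atom n → ℝ) (A : Atom n) (k : Fin n) (hc : 0 ≤ c) :
    slepianWolf μ ⊆ slepianWolf (transfer μ A k c) :=
  fun _ hR U => (condEntropy_transfer_le μ A k hc U).trans (hR U)

end Atom

end AtomMeasure

theorem Elemental.transfer_pairAvoiding_nonneg {μ : Atom 3 → ℝ} (hμ : Elemental μ) (k : Fin 3)
    (A : Atom 3) : 0 ≤ Atom.transfer μ (Atom.pairAvoiding k) k (μ Atom.triple)⁻ A := by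
  have hpair := hμ.pairAvoiding_add_triple_nonneg k
  have hne : Atom.triple ≠ Atom.pairAvoiding k := by fin_cases k <;> decide
  have hA := hμ.nonneg_of_ne_triple (A := A)
  simp only [Atom.transfer, Atom.insert_pairAvoiding, Pi.add_apply, Pi.sub_apply, Pi.single_apply,
    negPart_def]
  grind

/-- The flow variables `p` with the amounts on the virtual edges `(s*, v)` replaced by `g v`. -/
def FlowVars.withStorage {V : Type*} (p : FlowVars V) (g : Option V → ℝ) : FlowVars V where
  x := p.x
  z
    | none, v => g v
    | some u, v => p.z (some u) v

namespace Network

variable {V : Type*} {n : ℕ}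

/-- The variables of the atom problems with flow `p`, atom measures `μ` and the largest rates that
the flow supports. -/
def atomVars (N : Network V n) (p : FlowVars V) (μ : Atom n → ℝ) : AtomVars V n where
  toFlowVars := p
  R t i := p.x t none (some (N.src i))
  μ := μ

variable [DecidableEq V] {N : Network V n}

theorem mem_augEdges_virtual (N : Network V n) (i : Fin n) :
    (none, some (N.src i)) ∈ N.augEdges := by
  simp [augEdges]

theorem mem_augEdges_some {u v : V} : (some u, some v) ∈ N.augEdges ↔ (u, v) ∈ N.edges := by
  simp [augEdges]

theorem mem_augEdges_none {v : Option V} :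
    (none, v) ∈ N.augEdges ↔ ∃ i, some (N.src i) = v := by
  simp [augEdges]

theorem notMem_augEdges_to_none {u : Option V} : (u, none) ∉ N.augEdges := by
  simp [augEdges]

variable [Fintype V]

section Flow

variable {p : FlowVars V} {t : V}

theorem sum_virtual_edges (N : Network V n) (g : Option V → ℝ) :
    ∑ w with (none, w) ∈ N.augEdges, g w = ∑ i, g (some (N.src i)) := by
  have himage : ({w | (none, w) ∈ N.augEdges} : Finset (Option V)) =
      Finset.univ.image fun i => some (N.src i) := by
    ext w
    simp [mem_augEdges_none]
  rw [himage, Finset.sum_image fun i _ j _ hij => N.src.injective (Option.some_injective _ hij)]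

theorem FlowFeasible.sum_virtual (hp : N.FlowFeasible p) (ht : t ∈ N.terminals) :
    ∑ i, p.x t none (some (N.src i)) = N.h := by
  have hbalance := hp.2 t ht none
  rw [N.sum_virtual_edges fun w => p.x t none w] at hbalance
  simpa [notMem_augEdges_to_none, sigma] using hbalance

theorem FlowFeasible.virtual_nonneg (hp : N.FlowFeasible p) (ht : t ∈ N.terminals) (i : Fin n) :
    0 ≤ p.x t none (some (N.src i)) :=
  (hp.1 t ht _ _ (N.mem_augEdges_virtual i)).1

theorem FlowFeasible.virtual_le (hp : N.FlowFeasible p) (ht : t ∈ N.terminals) (i : Fin n) :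
    p.x t none (some (N.src i)) ≤ p.z none (some (N.src i)) :=
  (hp.1 t ht _ _ (N.mem_augEdges_virtual i)).2.1

theorem FlowFeasible.virtual_le_h (hp : N.FlowFeasible p) (ht : t ∈ N.terminals) (i : Fin n) :
    p.x t none (some (N.src i)) ≤ N.h := by
  rw [← hp.sum_virtual ht]
  exact Finset.single_le_sum (f := fun i => p.x t none (some (N.src i)))
    (fun j _ => hp.virtual_nonneg ht j) (Finset.mem_univ i)

theorem FlowFeasible.z_nonneg (hp : N.FlowFeasible p) {u v : Option V}
    (huv : (u, v) ∈ N.augEdges) : 0 ≤ p.z u v :=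
  have ⟨t, ht⟩ := N.terminals_nonempty
  (hp.1 t ht u v huv).1.trans (hp.1 t ht u v huv).2.1

theorem FlowFeasible.z_le_cap (hp : N.FlowFeasible p) {u v : V} (huv : (u, v) ∈ N.edges) :
    p.z (some u) (some v) ≤ N.cap u v :=
  have ⟨t, ht⟩ := N.terminals_nonempty
  EReal.coe_le_coe_iff.1 (hp.1 t ht _ _ (mem_augEdges_some.2 huv)).2.2

theorem FlowFeasible.h_le_sum_cut (hp : N.FlowFeasible p) (ht : t ∈ N.terminals)
    {W : Finset (Option V)} (hs : none ∉ W) (htW : some t ∈ W) :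
    N.h ≤ ∑ e ∈ N.augEdges with e.1 ∉ W ∧ e.2 ∈ W, p.x t e.1 e.2 := by
  have hsigma : ∑ v ∈ W, N.sigma t v = -N.h := by
    rw [Finset.sum_eq_single_of_mem _ htW fun v hv hvt => ?_]
    · simp [sigma]
    · simp [sigma, hvt, ne_of_mem_of_not_mem hv hs]
  have hout : 0 ≤ ∑ e ∈ N.augEdges with e.1 ∈ W ∧ e.2 ∉ W, p.x t e.1 e.2 :=
    Finset.sum_nonneg fun e he => (hp.1 t ht _ _ (Finset.mem_filter.1 he).1).1
  have hcut := sum_outflow_sub_sum_inflow N.augEdges W (p.x t)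
  rw [Finset.sum_congr rfl fun v _ => hp.2 t ht v, hsigma] at hcut
  linarith

theorem FlowFeasible.withStorage (hp : N.FlowFeasible p) {g : Option V → ℝ}
    (hg : ∀ t ∈ N.terminals, ∀ i, p.x t none (some (N.src i)) ≤ g (some (N.src i))) :
    N.FlowFeasible (p.withStorage g) := by
  refine ⟨fun t ht u v huv => ?_, hp.2⟩
  cases u with
  | none =>
    obtain ⟨i, rfl⟩ := mem_augEdges_none.1 huv
    exact ⟨hp.virtual_nonneg ht i, hg t ht i, le_top⟩
  | some u => exact hp.1 t ht _ v huv

theorem FlowFeasible.exists_virtual_le_h (hp : N.FlowFeasible p) :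
    ∃ q, N.FlowFeasible q ∧ (∀ i, q.z none (some (N.src i)) ≤ N.h) ∧
      N.codedCost q ≤ N.codedCost p :=
  ⟨p.withStorage fun v => min (p.z none v) N.h,
    hp.withStorage fun _ ht i => le_min (hp.virtual_le ht i) (hp.virtual_le_h ht i),
    fun _ => min_le_right _ _,
    add_le_add_right (Finset.sum_le_sum fun i _ =>
      mul_le_mul_of_nonneg_left (min_le_left _ _) (N.d_nonneg i)) _⟩

end Flow

section AtomVars

variable {μ : Atom n → ℝ}

theorem atomFeasible_atomVars {p : FlowVars V} :
    N.AtomFeasible (N.atomVars p μ) ↔ N.FlowFeasible p ∧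
      (∀ t ∈ N.terminals, (fun i => p.x t none (some (N.src i))) ∈ slepianWolf μ) ∧
      (∀ i, p.z none (some (N.src i)) = entropy μ i) ∧ N.h = ∑ A, μ A := by
  simp [AtomFeasible, atomVars]

variable {p : AtomVars V n}

theorem AtomFeasible.virtual_mem_slepianWolf (hp : N.AtomFeasible p) {t : V}
    (ht : t ∈ N.terminals) : (fun i => p.x t none (some (N.src i))) ∈ slepianWolf p.μ :=
  isUpperSet_slepianWolf p.μ (hp.2.1 t ht) (hp.2.2.1 t ht)

theorem AtomFeasible.subsetCost_eq (hp : N.AtomFeasible p) :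
    N.subsetCost p = N.codedCost p.toFlowVars := by
  simp only [subsetCost, codedCost, hp.2.2.2.1, sum_mul_entropy]

theorem AtomFeasible.single_le_virtual (hp : N.AtomFeasible p) {t : V} (ht : t ∈ N.terminals)
    (i : Fin n) : p.μ (Atom.single i) ≤ p.x t none (some (N.src i)) := by
  rw [← condEntropy_singleton p.μ]
  simpa using hp.virtual_mem_slepianWolf ht {i}

theorem FlowFeasible.exists_atomCodedFeasible {p : FlowVars V} (hp : N.FlowFeasible p)
    (hz : ∀ i, p.z none (some (N.src i)) ≤ N.h) :
    ∃ μ, N.AtomCodedFeasible (N.atomVars p μ) := by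
  have hz₀ (i) : 0 ≤ p.z none (some (N.src i)) := hp.z_nonneg (N.mem_augEdges_virtual i)
  obtain ⟨t₀, ht₀⟩ := N.terminals_nonempty
  obtain ⟨μ, hμ⟩ := exists_hasTruncatedEntropy (g := fun i => p.z none (some (N.src i)))
    ((hp.sum_virtual ht₀).ge.trans (Finset.sum_le_sum fun i _ => hp.virtual_le ht₀ i))
  exact ⟨μ, atomFeasible_atomVars.2 ⟨hp, fun t ht => hμ.mem_slepianWolf (hp.virtual_nonneg ht)
    (hp.virtual_le ht) (hp.sum_virtual ht).ge, fun i => (hμ.entropy_eq (hz₀ i) (hz i)).symm,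
    (hμ.sum_eq N.h_nonneg).symm⟩, hμ.elemental hz₀⟩

theorem AtomFeasible.exists_transfer (hp : N.AtomFeasible p) {A : Atom n} {k : Fin n}
    (hk : k ∉ A.1) {c : ℝ} (hc : 0 ≤ c) :
    ∃ q, N.AtomFeasible q ∧ q.μ = Atom.transfer p.μ A k c ∧
      N.codedCost q.toFlowVars = N.codedCost p.toFlowVars + N.d k * c := by
  let g (v : Option V) : ℝ := p.z none v + if v = some (N.src k) then c else 0
  have hg (i) : g (some (N.src i)) = p.z none (some (N.src i)) + if i = k then c else 0 := by
    simp [g]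
  have hflow : N.FlowFeasible (p.toFlowVars.withStorage g) :=
    hp.1.withStorage fun t ht i => (hp.1.virtual_le ht i).trans <|
      (hg i).symm ▸ le_add_of_nonneg_right (by split_ifs <;> simp [hc])
  refine ⟨N.atomVars (p.toFlowVars.withStorage g) (Atom.transfer p.μ A k c),
    atomFeasible_atomVars.2 ⟨hflow, fun t ht => ?_, fun i => ?_, ?_⟩, rfl, ?_⟩
  · exact Atom.slepianWolf_subset_transfer p.μ A k hc (hp.virtual_mem_slepianWolf ht)
  · rw [Atom.entropy_transfer p.μ hk, ← hp.2.2.2.1 i]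
    exact hg i
  · rw [Atom.sum_transfer, hp.2.2.2.2]
  · change N.edgeCost p.toFlowVars + ∑ i, N.d i * g (some (N.src i)) = _
    simp only [hg, codedCost, mul_add, mul_ite, mul_zero, Finset.sum_add_distrib,
      Finset.sum_ite_eq', Finset.mem_univ, if_true, add_assoc]

end AtomVars

end Network

/-- The flow variables as pairs `(x, z)`, in a product type with its topology and order. -/
abbrev FlowPoint (V : Type*) : Type _ :=
  (V → Option V → Option V → ℝ) × (Option V → Option V → ℝ)

namespace Network

variable {V : Type*} {n : ℕ}

/-- A bound on all variables of a restricted feasible flow with at most `h` on each virtual edge. -/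
def flowBound (N : Network V n) : ℝ := N.h + ∑ e ∈ N.edges, |N.cap e.1 e.2|

theorem flowBound_nonneg (N : Network V n) : 0 ≤ N.flowBound :=
  add_nonneg N.h_nonneg (Finset.sum_nonneg fun _ _ => abs_nonneg _)

theorem continuous_codedCost (N : Network V n) :
    Continuous fun q : FlowPoint V => N.codedCost ⟨q.1, q.2⟩ := by
  unfold codedCost edgeCost
  fun_prop

variable [DecidableEq V]

/-- The flow variables `p` with all irrelevant values, those away from terminals and from edges of
`G*`, set to `0`. -/
def restrict (N : Network V n) (p : FlowVars V) : FlowVars V where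
  x t u v := if t ∈ N.terminals ∧ (u, v) ∈ N.augEdges then p.x t u v else 0
  z u v := if (u, v) ∈ N.augEdges then p.z u v else 0

theorem codedCost_restrict (N : Network V n) (p : FlowVars V) :
    N.codedCost (N.restrict p) = N.codedCost p := by
  have hedge (e) (he : e ∈ N.edges) : (N.restrict p).z (some e.1) (some e.2) =
      p.z (some e.1) (some e.2) := if_pos (mem_augEdges_some.2 he)
  have hvirtual (i) : (N.restrict p).z none (some (N.src i)) = p.z none (some (N.src i)) :=
    if_pos (N.mem_augEdges_virtual i)
  simp only [codedCost, edgeCost, hvirtual]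
  rw [Finset.sum_congr rfl fun e he => by rw [hedge e he]]

variable [Fintype V] {N : Network V n} {p : FlowVars V}

theorem FlowFeasible.restrict (hp : N.FlowFeasible p) : N.FlowFeasible (N.restrict p) := by
  refine ⟨fun t ht u v huv => ?_, fun t ht v => ?_⟩
  · simpa only [Network.restrict, ht, huv, and_self, if_true] using hp.1 t ht u v huv
  · rw [← hp.2 t ht v]
    congr 1 <;> exact Finset.sum_congr rfl fun w hw => if_pos ⟨ht, (Finset.mem_filter.1 hw).2⟩

theorem FlowFeasible.z_le_flowBound (hp : N.FlowFeasible p)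
    (hz : ∀ i, p.z none (some (N.src i)) ≤ N.h) {u v : Option V} (huv : (u, v) ∈ N.augEdges) :
    p.z u v ≤ N.flowBound := by
  match u, v with
  | none, _ =>
    obtain ⟨i, rfl⟩ := mem_augEdges_none.1 huv
    exact (hz i).trans (le_add_of_nonneg_right (Finset.sum_nonneg fun _ _ => abs_nonneg _))
  | some _, none => exact absurd huv notMem_augEdges_to_none
  | some u, some v =>
    have he := mem_augEdges_some.1 huv
    have hcap : |N.cap u v| ≤ ∑ e ∈ N.edges, |N.cap e.1 e.2| :=
      Finset.single_le_sum (f := fun e => |N.cap e.1 e.2|) (fun _ _ => abs_nonneg _) he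
    exact (hp.z_le_cap he).trans
      ((le_abs_self _).trans (hcap.trans (le_add_of_nonneg_left N.h_nonneg)))

theorem FlowFeasible.restrict_mem_Icc (hp : N.FlowFeasible p)
    (hz : ∀ i, p.z none (some (N.src i)) ≤ N.h) :
    ((N.restrict p).x, (N.restrict p).z) ∈
      Set.Icc 0 (fun _ _ _ => N.flowBound, fun _ _ => N.flowBound) := by
  have hx (t u v) : (N.restrict p).x t u v ∈ Set.Icc 0 N.flowBound := by
    simp only [Network.restrict]
    split_ifs with h
    · obtain ⟨h_nonneg, h_le, -⟩ := hp.1 t h.1 u v h.2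
      exact ⟨h_nonneg, h_le.trans (hp.z_le_flowBound hz h.2)⟩
    · exact ⟨le_rfl, N.flowBound_nonneg⟩
  have hz' (u v) : (N.restrict p).z u v ∈ Set.Icc 0 N.flowBound := by
    simp only [Network.restrict]
    split_ifs with h
    · exact ⟨hp.z_nonneg h, hp.z_le_flowBound hz h⟩
    · exact ⟨le_rfl, N.flowBound_nonneg⟩
  exact ⟨⟨fun t u v => (hx t u v).1, fun u v => (hz' u v).1⟩,
    fun t u v => (hx t u v).2, fun u v => (hz' u v).2⟩

theorem isClosed_setOf_flowFeasible (N : Network V n) :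
    IsClosed {q : FlowPoint V | N.FlowFeasible ⟨q.1, q.2⟩} := by
  simp only [FlowFeasible, Set.ofPred_and, Set.ofPred_forall]
  refine (isClosed_iInter fun t => isClosed_iInter fun _ => isClosed_iInter fun u =>
    isClosed_iInter fun v => isClosed_iInter fun _ => ?_).inter
    (isClosed_iInter fun t => isClosed_iInter fun _ => isClosed_iInter fun v =>
      isClosed_eq (by fun_prop) continuous_const)
  exact (isClosed_le continuous_const (by fun_prop)).inter ((isClosed_le (by fun_prop)
    (by fun_prop)).inter (isClosed_le (continuous_coe_real_ereal.comp (by fun_prop))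
    continuous_const))

theorem exists_isCodedMinCost (hN : ∃ p, N.FlowFeasible p) : ∃ c, N.IsCodedMinCost c := by
  let K : Set (FlowPoint V) := {q | N.FlowFeasible ⟨q.1, q.2⟩} ∩
    Set.Icc 0 (fun _ _ _ => N.flowBound, fun _ _ => N.flowBound)
  have hK : IsCompact K := isCompact_Icc.inter_left N.isClosed_setOf_flowFeasible
  have hmem {p} (hp : N.FlowFeasible p) :
      ∃ q ∈ K, N.codedCost ⟨q.1, q.2⟩ ≤ N.codedCost p := by
    obtain ⟨q, hq, hqz, hqp⟩ := hp.exists_virtual_le_h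
    exact ⟨_, ⟨hq.restrict, hq.restrict_mem_Icc hqz⟩, (N.codedCost_restrict q).trans_le hqp⟩
  obtain ⟨p₀, hp₀⟩ := hN
  obtain ⟨q₀, hq₀, -⟩ := hmem hp₀
  obtain ⟨q, hq, hmin⟩ := hK.exists_isMinOn ⟨q₀, hq₀⟩ N.continuous_codedCost.continuousOn
  refine ⟨_, ⟨⟨q.1, q.2⟩, hq.1, rfl⟩, ?_⟩
  rintro _ ⟨p, hp, rfl⟩
  obtain ⟨p', hp', hle⟩ := hmem hp
  exact (hmin hp').trans hle

theorem IsCodedMinCost.exists_atomCodedOptimal {c : ℝ} (hc : N.IsCodedMinCost c) :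
    ∃ p, N.AtomCodedOptimal p ∧ N.codedCost p.toFlowVars = c := by
  obtain ⟨⟨p, hp, rfl⟩, hmin⟩ := hc
  obtain ⟨q, hq, hqz, hqp⟩ := hp.exists_virtual_le_h
  obtain ⟨μ, hμ⟩ := hq.exists_atomCodedFeasible hqz
  exact ⟨N.atomVars q μ, ⟨hμ, fun r hr => hqp.trans (hmin ⟨_, hr.1.1, rfl⟩)⟩,
    hqp.antisymm (hmin ⟨q, hq, rfl⟩)⟩

theorem AtomCodedOptimal.codedCost_eq {p : AtomVars V n} (hp : N.AtomCodedOptimal p) {c : ℝ}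
    (hc : N.IsCodedMinCost c) : N.codedCost p.toFlowVars = c := by
  obtain ⟨q, hq, rfl⟩ := hc.exists_atomCodedOptimal
  exact (hp.2 q hq.1).antisymm (hq.2 p hp.1)

section Subset

variable {p : AtomVars V n}

theorem SubsetFeasible.restrict (hp : N.SubsetFeasible p) :
    N.SubsetFeasible (N.atomVars (N.restrict p.toFlowVars) p.μ) := by
  refine ⟨atomFeasible_atomVars.2
    ⟨hp.1.1.restrict, fun t ht => ?_, fun i => ?_, hp.1.2.2.2.2⟩, hp.2⟩
  · simpa only [Network.restrict, ht, N.mem_augEdges_virtual, and_self, if_true] using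
      hp.1.virtual_mem_slepianWolf ht
  · simpa only [Network.restrict, N.mem_augEdges_virtual, if_true] using hp.1.2.2.2.1 i

theorem SubsetFeasible.le_h (hp : N.SubsetFeasible p) (A : Atom n) : p.μ A ≤ N.h := by
  rw [hp.1.2.2.2.2]
  exact Finset.single_le_sum (fun A _ => hp.2 A) (Finset.mem_univ A)

theorem SubsetFeasible.virtual_le_h (hp : N.SubsetFeasible p) (i : Fin n) :
    p.z none (some (N.src i)) ≤ N.h := by
  rw [hp.1.2.2.2.1, hp.1.2.2.2.2]
  exact entropy_le_sum hp.2 i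

theorem isClosed_setOf_subsetFeasible (N : Network V n) : IsClosed
    {q : FlowPoint V × (Atom n → ℝ) | N.SubsetFeasible (N.atomVars ⟨q.1.1, q.1.2⟩ q.2)} := by
  simp only [SubsetFeasible, atomFeasible_atomVars, entropy, Set.ofPred_and, Set.ofPred_forall]
  refine ((N.isClosed_setOf_flowFeasible.preimage continuous_fst).inter
    ((isClosed_iInter fun t => isClosed_iInter fun _ => ?_).inter
      ((isClosed_iInter fun i => ?_).inter ?_))).inter (isClosed_iInter fun A => ?_)
  · exact isClosed_setOf_mem_slepianWolf.preimage
      (f := fun q : FlowPoint V × (Atom n → ℝ) => (fun i => q.1.1 t none (some (N.src i)), q.2))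
      (by fun_prop)
  · exact isClosed_eq (by fun_prop) (by fun_prop)
  · exact isClosed_eq continuous_const (by fun_prop)
  · exact isClosed_le continuous_const (by fun_prop)

theorem exists_isSubsetMinCost (hN : ∃ p, N.SubsetFeasible p) : ∃ c, N.IsSubsetMinCost c := by
  let K : Set (FlowPoint V × (Atom n → ℝ)) :=
    {q | N.SubsetFeasible (N.atomVars ⟨q.1.1, q.1.2⟩ q.2)} ∩
      Set.Icc 0 (fun _ _ _ => N.flowBound, fun _ _ => N.flowBound) ×ˢ Set.Icc 0 fun _ => N.h
  have hK : IsCompact K :=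
    (isCompact_Icc.prod isCompact_Icc).inter_left N.isClosed_setOf_subsetFeasible
  have hmem {p} (hp : N.SubsetFeasible p) :
      (((N.restrict p.toFlowVars).x, (N.restrict p.toFlowVars).z), p.μ) ∈ K :=
    ⟨hp.restrict, hp.1.1.restrict_mem_Icc hp.virtual_le_h, hp.2, hp.le_h⟩
  obtain ⟨p₀, hp₀⟩ := hN
  obtain ⟨q, hq, hmin⟩ := hK.exists_isMinOn ⟨_, hmem hp₀⟩
    (N.continuous_codedCost.comp continuous_fst).continuousOn
  refine ⟨_, ⟨_, hq.1, hq.1.1.subsetCost_eq⟩, ?_⟩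
  rintro _ ⟨p, hp, rfl⟩
  rw [hp.1.subsetCost_eq, ← N.codedCost_restrict p.toFlowVars]
  exact hmin (hmem hp)

theorem IsCodedMinCost.le_isSubsetMinCost {c s : ℝ} (hc : N.IsCodedMinCost c)
    (hs : N.IsSubsetMinCost s) : c ≤ s := by
  obtain ⟨⟨p, hp, rfl⟩, -⟩ := hs
  rw [hp.1.subsetCost_eq]
  exact hc.2 ⟨_, hp.1.1, rfl⟩

end Subset

end Network

namespace Network

variable {V : Type*}

theorem exists_minD_eq (N : Network V 3) : ∃ k, N.minD = N.d k :=
  have ⟨k, _, hk⟩ := Finset.univ.exists_mem_eq_inf' Finset.univ_nonempty N.d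
  ⟨k, hk⟩

variable [DecidableEq V] [Fintype V] {N : Network V 3} {p : AtomVars V 3}

theorem AtomCodedFeasible.exists_subsetFeasible (hp : N.AtomCodedFeasible p) (k : Fin 3) :
    ∃ q, N.SubsetFeasible q ∧
      N.subsetCost q = N.codedCost p.toFlowVars + N.d k * (p.μ Atom.triple)⁻ := by
  obtain ⟨q, hq, hμ, hcost⟩ := hp.1.exists_transfer (A := Atom.pairAvoiding k) (k := k)
    (by simp [Atom.pairAvoiding]) (negPart_nonneg (p.μ Atom.triple))
  exact ⟨q, ⟨hq, hμ ▸ hp.2.transfer_pairAvoiding_nonneg k⟩, hq.subsetCost_eq.trans hcost⟩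

theorem IsSubsetMinCost.sub_le {s c : ℝ} (hs : N.IsSubsetMinCost s) (hc : N.IsCodedMinCost c)
    (hp : N.AtomCodedOptimal p) : s - c ≤ N.minD * (p.μ Atom.triple)⁻ := by
  obtain ⟨k, hk⟩ := N.exists_minD_eq
  obtain ⟨q, hq, hcost⟩ := hp.1.exists_subsetFeasible k
  rw [sub_le_iff_le_add', ← hp.codedCost_eq hc, hk, ← hcost]
  exact hs.2 ⟨q, hq, rfl⟩

theorem IsSubsetMinCost.eq_of_triple_nonneg {s c : ℝ} (hs : N.IsSubsetMinCost s)
    (hc : N.IsCodedMinCost c) (hp : N.AtomCodedOptimal p) (hb : 0 ≤ p.μ Atom.triple) :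
    s = c := by
  have hsub := hs.sub_le hc hp
  rw [negPart_eq_zero.2 hb, mul_zero, sub_nonpos] at hsub
  exact hsub.antisymm (hc.le_isSubsetMinCost hs)

theorem AtomCodedFeasible.minD_mul_neg_triple_le (hp : N.AtomCodedFeasible p) :
    N.minD * -p.μ Atom.triple ≤ N.minD * (N.h / 2) := by
  obtain ⟨k, hk⟩ := N.exists_minD_eq
  rw [hk, hp.1.2.2.2.2]
  exact mul_le_mul_of_nonneg_left hp.2.neg_triple_le (N.d_nonneg k)

end Network

/-- A network whose edges are saturated by every feasible flow: the source nodes `0` and `1` feed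
the terminals `5` (through the relays `3` and `4`) and `8`, the source nodes `0` and `2` feed the
terminal `6`, and the source nodes `1` and `2` feed the terminal `7`. -/
noncomputable def saturatedNetwork : Network (Fin 9) 3 where
  edges := {(0, 3), (1, 3), (3, 5), (3, 4), (4, 5), (0, 6), (2, 6), (1, 7), (2, 7), (0, 8), (1, 8)}
  cap _ _ := 1
  f _ _ := 1
  src := ⟨![0, 1, 2], by decide⟩
  terminals := {5, 6, 7, 8}
  terminals_nonempty := ⟨5, by decide⟩
  d := ![2, 2, 1]
  d_nonneg i := by fin_cases i <;> simp
  h := 2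
  h_nonneg := by norm_num

namespace saturatedNetwork

theorem minD_eq : saturatedNetwork.minD = 1 := by
  refine le_antisymm (Finset.inf'_le (b := 2) saturatedNetwork.d (Finset.mem_univ _))
    (Finset.le_inf' _ _ fun i _ => ?_)
  fin_cases i <;> norm_num [saturatedNetwork]

theorem codedCost_eq (p : FlowVars (Fin 9)) :
    saturatedNetwork.codedCost p = saturatedNetwork.edgeCost p +
      (2 * p.z none (some (saturatedNetwork.src 0)) + 2 * p.z none (some (saturatedNetwork.src 1)) +
        p.z none (some (saturatedNetwork.src 2))) := by
  rw [Network.codedCost, Fin.sum_univ_three]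
  simp [saturatedNetwork]

theorem edgeCost_eq (p : FlowVars (Fin 9)) :
    saturatedNetwork.edgeCost p = ∑ e ∈ saturatedNetwork.edges, p.z (some e.1) (some e.2) :=
  Finset.sum_congr rfl fun _ _ => one_mul _

/-- The edges `e` and `e'` are distinct and are the only edges of `G*` entering the vertex set `W`,
which contains the terminal `t` but not `s*`. An abbreviation, so that instances are decidable. -/
abbrev IsTwoEdgeCut (t : Fin 9) (W : Finset (Option (Fin 9)))
    (e e' : Option (Fin 9) × Option (Fin 9)) : Prop :=
  t ∈ saturatedNetwork.terminals ∧ none ∉ W ∧ some t ∈ W ∧ e ≠ e' ∧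
    {a ∈ saturatedNetwork.augEdges | a.1 ∉ W ∧ a.2 ∈ W} = {e, e'}

theorem IsTwoEdgeCut.symm {t : Fin 9} {W : Finset (Option (Fin 9))}
    {e e' : Option (Fin 9) × Option (Fin 9)} (hW : IsTwoEdgeCut t W e e') :
    IsTwoEdgeCut t W e' e :=
  ⟨hW.1, hW.2.1, hW.2.2.1, hW.2.2.2.1.symm, hW.2.2.2.2.trans (Finset.pair_comm e e')⟩

section Saturation

variable {p : FlowVars (Fin 9)}

theorem IsTwoEdgeCut.one_le_x {t u v : Fin 9} {W : Finset (Option (Fin 9))}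
    {e : Option (Fin 9) × Option (Fin 9)} (hW : IsTwoEdgeCut t W e (some u, some v))
    (hp : saturatedNetwork.FlowFeasible p) : 1 ≤ p.x t e.1 e.2 := by
  obtain ⟨ht, hs, htW, hne, hcut⟩ := hW
  have huv : (some u, some v) ∈ saturatedNetwork.augEdges :=
    (Finset.mem_filter.1 (hcut ▸ Finset.mem_insert_of_mem (Finset.mem_singleton_self _))).1
  have hle : p.x t (some u) (some v) ≤ 1 :=
    (hp.1 t ht _ _ huv).2.1.trans (hp.z_le_cap (Network.mem_augEdges_some.1 huv))
  have hsum : 2 ≤ ∑ e ∈ saturatedNetwork.augEdges with e.1 ∉ W ∧ e.2 ∈ W, p.x t e.1 e.2 :=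
    hp.h_le_sum_cut ht hs htW
  rw [hcut, Finset.sum_pair hne] at hsum
  linarith

theorem IsTwoEdgeCut.one_le_z {t u v u' v' : Fin 9} {W : Finset (Option (Fin 9))}
    (hW : IsTwoEdgeCut t W (some u, some v) (some u', some v'))
    (hp : saturatedNetwork.FlowFeasible p) :
    1 ≤ p.z (some u) (some v) ∧ 1 ≤ p.z (some u') (some v') := by
  have ⟨ht, _, _, _, hcut⟩ := hW
  have hle (e) (he : e ∈ ({(some u, some v), (some u', some v')} : Finset _)) :
      p.x t e.1 e.2 ≤ p.z e.1 e.2 :=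
    (hp.1 t ht _ _ (Finset.mem_filter.1 (hcut ▸ he)).1).2.1
  exact ⟨(hW.one_le_x hp).trans (hle _ (Finset.mem_insert_self _ _)),
    (hW.symm.one_le_x hp).trans (hle _ (Finset.mem_insert_of_mem (Finset.mem_singleton_self _)))⟩

theorem one_le_z (hp : saturatedNetwork.FlowFeasible p) :
    ∀ e ∈ saturatedNetwork.edges, 1 ≤ p.z (some e.1) (some e.2) := by
  have hcut_345 : IsTwoEdgeCut 5 {some 3, some 4, some 5} (some 0, some 3) (some 1, some 3) := by
    decide
  have hcut_45 : IsTwoEdgeCut 5 {some 4, some 5} (some 3, some 5) (some 3, some 4) := by decide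
  have hcut_5 : IsTwoEdgeCut 5 {some 5} (some 3, some 5) (some 4, some 5) := by decide
  have hcut_6 : IsTwoEdgeCut 6 {some 6} (some 0, some 6) (some 2, some 6) := by decide
  have hcut_7 : IsTwoEdgeCut 7 {some 7} (some 1, some 7) (some 2, some 7) := by decide
  have hcut_8 : IsTwoEdgeCut 8 {some 8} (some 0, some 8) (some 1, some 8) := by decide
  simp [saturatedNetwork, hcut_345.one_le_z hp, hcut_45.one_le_z hp, hcut_5.one_le_z hp,
    hcut_6.one_le_z hp, hcut_7.one_le_z hp, hcut_8.one_le_z hp]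

theorem eleven_le_edgeCost (hp : saturatedNetwork.FlowFeasible p) :
    11 ≤ saturatedNetwork.edgeCost p := by
  have hcard : saturatedNetwork.edges.card = 11 := rfl
  simpa [edgeCost_eq, hcard] using Finset.card_nsmul_le_sum _ _ _ (one_le_z hp)

theorem exists_terminal_one_le_virtual (hp : saturatedNetwork.FlowFeasible p) (i : Fin 3) :
    ∃ t ∈ saturatedNetwork.terminals, ∀ j ≠ i,
      1 ≤ p.x t none (some (saturatedNetwork.src j)) := by
  have hcut : ∀ i, ∃ t ∈ saturatedNetwork.terminals, ∀ j ≠ i, ∃ k,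
      IsTwoEdgeCut t {some (saturatedNetwork.src j), some t}
        (none, some (saturatedNetwork.src j)) (some k, some t) := by
    decide
  obtain ⟨t, ht, hcut⟩ := hcut i
  exact ⟨t, ht, fun j hj => have ⟨_, hk⟩ := hcut j hj; hk.one_le_x hp⟩

theorem one_le_storage (hp : saturatedNetwork.FlowFeasible p) (j : Fin 3) :
    1 ≤ p.z none (some (saturatedNetwork.src j)) := by
  obtain ⟨i, hji⟩ := exists_ne j
  obtain ⟨t, ht, hone⟩ := exists_terminal_one_le_virtual hp i
  exact (hone j hji.symm).trans (hp.virtual_le ht j)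

theorem exists_terminal_virtual_nonpos (hp : saturatedNetwork.FlowFeasible p) (i : Fin 3) :
    ∃ t ∈ saturatedNetwork.terminals, p.x t none (some (saturatedNetwork.src i)) ≤ 0 := by
  obtain ⟨t, ht, hone⟩ := exists_terminal_one_le_virtual hp i
  refine ⟨t, ht, ?_⟩
  have hrest : (2 : ℝ) ≤ ∑ j ∈ {i}ᶜ, p.x t none (some (saturatedNetwork.src j)) := by
    simpa [Finset.card_compl] using
      Finset.card_nsmul_le_sum {i}ᶜ _ 1 fun j hj => hone j (by simpa using hj)
  have hsum : ∑ j, p.x t none (some (saturatedNetwork.src j)) = 2 := hp.sum_virtual ht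
  rw [Fintype.sum_eq_add_sum_compl i] at hsum
  linarith

end Saturation

/-- The edges on which `unitFlow` sends one unit to the terminal `t`. -/
def pathEdges (t : Fin 9) : Finset (Option (Fin 9) × Option (Fin 9)) :=
  if t = 5 then {(none, some 0), (none, some 1), (some 0, some 3), (some 1, some 3),
    (some 3, some 5), (some 3, some 4), (some 4, some 5)}
  else if t = 6 then {(none, some 0), (none, some 2), (some 0, some 6), (some 2, some 6)}
  else if t = 7 then {(none, some 1), (none, some 2), (some 1, some 7), (some 2, some 7)}
  else {(none, some 0), (none, some 1), (some 0, some 8), (some 1, some 8)}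

/-- The feasible flow that stores one unit at each source. -/
def unitFlow : FlowVars (Fin 9) where
  x t u v := if (u, v) ∈ pathEdges t then 1 else 0
  z _ _ := 1

theorem pathEdges_balance : ∀ t ∈ saturatedNetwork.terminals, ∀ v : Option (Fin 9),
    (Finset.univ.filter fun w => (v, w) ∈ saturatedNetwork.augEdges ∧ (v, w) ∈ pathEdges t).card +
      (if v = some t then 2 else 0) =
    (Finset.univ.filter fun w => (w, v) ∈ saturatedNetwork.augEdges ∧ (w, v) ∈ pathEdges t).card +
      if v = none then 2 else 0 := by
  decide

theorem flowFeasible_unitFlow : saturatedNetwork.FlowFeasible unitFlow := by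
  refine ⟨fun t _ u v _ => ⟨?_, ?_, ?_⟩, fun t ht v => ?_⟩
  · simp only [unitFlow]
    split_ifs <;> norm_num
  · simp only [unitFlow]
    split_ifs <;> norm_num
  · cases u <;> cases v <;> first | exact le_top | exact le_rfl
  · have hbalance := congrArg (Nat.cast : ℕ → ℝ) (pathEdges_balance t ht v)
    have hh : saturatedNetwork.h = 2 := rfl
    push_cast at hbalance
    simp only [unitFlow, Finset.sum_boole, Finset.filter_filter, Network.sigma, hh]
    grind

theorem isCodedMinCost : saturatedNetwork.IsCodedMinCost 16 := by
  refine ⟨⟨unitFlow, flowFeasible_unitFlow, ?_⟩, ?_⟩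
  · have hcard : saturatedNetwork.edges.card = 11 := rfl
    norm_num [codedCost_eq, edgeCost_eq, unitFlow, hcard]
  · rintro _ ⟨p, hp, rfl⟩
    rw [codedCost_eq]
    linarith [eleven_le_edgeCost hp, one_le_storage hp 0, one_le_storage hp 1, one_le_storage hp 2]

section Atoms

variable {p : AtomVars (Fin 9) 3}

theorem single_nonpos (hp : saturatedNetwork.AtomFeasible p) (i : Fin 3) :
    p.μ (Atom.single i) ≤ 0 :=
  have ⟨_, ht, hx⟩ := exists_terminal_virtual_nonpos hp.1 i
  (hp.single_le_virtual ht i).trans hx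

theorem sum_storage_eq (hp : saturatedNetwork.AtomFeasible p) :
    ∑ i, p.z none (some (saturatedNetwork.src i)) =
      4 - ∑ i, p.μ (Atom.single i) + p.μ Atom.triple := by
  have hh : 2 = ∑ A, p.μ A := hp.2.2.2.2
  rw [Finset.sum_congr rfl fun i _ => hp.2.2.2.1 i, sum_entropy_three, ← hh]
  norm_num

theorem triple_eq_of_optimal (hp : saturatedNetwork.AtomCodedOptimal p) :
    p.μ Atom.triple = -1 := by
  have hcost := hp.codedCost_eq isCodedMinCost
  have hsingle : ∑ i, p.μ (Atom.single i) = 0 := Finset.sum_eq_zero fun i _ =>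
    (single_nonpos hp.1.1 i).antisymm (hp.1.2.nonneg_of_card_le_two (by simp [Atom.single]))
  have hstorage := sum_storage_eq hp.1.1
  have hone := one_le_storage hp.1.1.1
  rw [codedCost_eq] at hcost
  rw [hsingle, Fin.sum_univ_three] at hstorage
  linarith [eleven_le_edgeCost hp.1.1.1, hone 0, hone 1, hone 2]

theorem seventeen_le_subsetCost (hp : saturatedNetwork.SubsetFeasible p) :
    17 ≤ saturatedNetwork.subsetCost p := by
  have hsingle : ∑ i, p.μ (Atom.single i) ≤ 0 := Finset.sum_nonpos fun i _ => single_nonpos hp.1 i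
  have hstorage := sum_storage_eq hp.1
  have hone := one_le_storage hp.1.1
  rw [Fin.sum_univ_three] at hstorage
  rw [hp.1.subsetCost_eq, codedCost_eq]
  linarith [eleven_le_edgeCost hp.1.1, hone 0, hone 1, hp.2 Atom.triple]

theorem isSubsetMinCost : saturatedNetwork.IsSubsetMinCost 17 := by
  obtain ⟨p, hp, hcost⟩ := isCodedMinCost.exists_atomCodedOptimal
  obtain ⟨q, hq, hqp⟩ := hp.1.exists_subsetFeasible 2
  refine ⟨⟨q, hq, ?_⟩, ?_⟩
  · have hd : saturatedNetwork.d 2 = 1 := rfl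
    norm_num [hqp, hcost, triple_eq_of_optimal hp, hd]
  · rintro _ ⟨r, hr, rfl⟩
    exact seventeen_le_subsetCost hr

end Atoms

end saturatedNetwork

theorem mainTheorem1 :
    (∀ (V : Type*) [Fintype V] [DecidableEq V] (N : Network V 3),
      (∃ p, N.FlowFeasible p) →
      ∃ fsubset fcoded : ℝ,
        N.IsSubsetMinCost fsubset ∧ N.IsCodedMinCost fcoded ∧
        (∃ p, N.AtomCodedOptimal p) ∧
        ∀ p, N.AtomCodedOptimal p →
          N.codedCost p.toFlowVars = fcoded ∧
          (0 ≤ p.μ Atom.triple → fsubset = fcoded) ∧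
          (p.μ Atom.triple < 0 →
            fsubset - fcoded ≤ N.minD * |p.μ Atom.triple| ∧
            N.minD * |p.μ Atom.triple| ≤ N.minD * (N.h / 2))) ∧
    (∃ N : Network (Fin 9) 3,
      (∀ e ∈ N.edges, N.cap e.1 e.2 = 1 ∧ N.f e.1 e.2 = 1) ∧
      (N.src : Fin 3 → Fin 9) = ![0, 1, 2] ∧ N.terminals = {5, 6, 7, 8} ∧
      N.d = ![2, 2, 1] ∧ N.h = 2 ∧
      N.IsSubsetMinCost 17 ∧ N.IsCodedMinCost 16 ∧
      (∃ p, N.AtomCodedOptimal p) ∧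
      ∀ p, N.AtomCodedOptimal p →
        p.μ Atom.triple < 0 ∧
        (17 : ℝ) - 16 = N.minD * |p.μ Atom.triple| ∧
        N.minD * |p.μ Atom.triple| = N.minD * (N.h / 2)) := by
  refine ⟨fun V _ _ N hN => ?_, saturatedNetwork, fun _ _ => ⟨rfl, rfl⟩, rfl, rfl, rfl, rfl,
    saturatedNetwork.isSubsetMinCost, saturatedNetwork.isCodedMinCost, ?_, fun p hp => ?_⟩
  · obtain ⟨c, hc⟩ := Network.exists_isCodedMinCost hN
    obtain ⟨p₀, hp₀, -⟩ := hc.exists_atomCodedOptimal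
    obtain ⟨q, hq, -⟩ := hp₀.1.exists_subsetFeasible 0
    obtain ⟨s, hs⟩ := Network.exists_isSubsetMinCost ⟨q, hq⟩
    refine ⟨s, c, hs, hc, ⟨p₀, hp₀⟩, fun p hp =>
      ⟨hp.codedCost_eq hc, hs.eq_of_triple_nonneg hc hp, fun hb => ?_⟩⟩
    have hsub := hs.sub_le hc hp
    rw [negPart_of_nonpos hb.le] at hsub
    rw [abs_of_neg hb]
    exact ⟨hsub, hp.1.minD_mul_neg_triple_le⟩
  · obtain ⟨p, hp, -⟩ := saturatedNetwork.isCodedMinCost.exists_atomCodedOptimal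
    exact ⟨p, hp⟩
  · have hh : saturatedNetwork.h = 2 := rfl
    rw [saturatedNetwork.triple_eq_of_optimal hp, saturatedNetwork.minD_eq, hh]
    norm_num
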